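/- **Second singular approximation lemma.** Let $X=(x_0,x_1)$ be a bounded interval, $x_0<x_1$. A function on $X$ is *regulated* if it is a uniform limit of step functions (piecewise constant functions with finitely many discontinuities). Let $\zeta\in C^1_+(X)$, i.e. $\zeta:X\to\mathbb{R}$ is continuously differentiable, regulated, bounded below by a positive constant, and $\zeta'$ is regulated. Set $\alpha=-\zeta'/(2\zeta)$. *Regular harmonic exponential.* For real $\omega$ let $\mathcal{A}_\omega$ be the conjugate-linear operator on $C([x_0,x_1])$ given by $$\mathcal{A}_\omega f(y)=\int_{x_0}^y\alpha(x)e^{2i(x-x_0)\omega}\overline{f(x)}\,dx,$$ and put $E_\alpha^{(x_0,y)}(\omega)=(1-\mathcal{A}_\omega)^{-1}\mathbb{1}(y)$ for $x_0<y\le x_1$. *Singular harmonic exponential.* For a strictly positive step function $\sigma$ on an interval $(x_0,b)$ let $r_\sigma(x)=\frac{\sigma(x-)-\sigma(x+)}{\sigma(x-)+\sigma(x+)}$, which is non-zero only at the jump points of $\sigma$. For real $\omega$ define $\mathcal{Z}_\omega$ on step functions by $$\mathcal{Z}_\omega f(y)=\sum_{x_0<x<y}r_\sigma(x)e^{2i(x-x_0)\omega}\overline{f(x)}\qquad(x_0<y\le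 b),$$ and put $\mathcal{E}_\sigma^{(x_0,y)}(\omega)=(1-\mathcal{Z}_\omega)^{-1}\mathbb{1}(y)$ for $x_0<y\le b$. *Standard approximation.* For an interval $(x_0,b)\subseteq X$ and $n\ge1$ set $\Delta_n=(b-x_0)/(n+1)$ and $y_{n,j}=x_0+j\Delta_n$ $(0\le j\le n+1)$; the $n$th standard approximant of $\zeta$ on $(x_0,b)$ is the step function $\zeta_n(x)=\zeta(y_{n,j}+\Delta_n/2)$ for $y_{n,j}\le x<y_{n,j+1}$, $0\le j\le n$. *Dual OPUC.* The monic orthogonal polynomials on the unit circle with Verblunsky coefficients $a_1,a_2,\ldots$ are given by $\Phi_0=1$, $\Phi_{j+1}(z)=z\Phi_j(z)-\overline{a_{j+1}}\,\Phi_j^*(z)$, where $\Phi_j^*(z)=z^j\overline{\Phi_j(1/\bar z)}$ is the dual polynomial. Then $\alpha\in L^1(X)$, the inverses $(1-\mathcal{A}_\omega)^{-1}$ and, for every $\zeta_n$, $(1-\mathcal{Z}_\omega)^{-1}$ exist for every $\omega\in\mathbb{R}$, and for every $y\in(x_0,x_1]$: 1. If $\zeta_n$ is the $n$th standard approximant of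 $\zeta$ on $X=(x_0,x_1)$, then $$\mathcal{E}_{\zeta_n}^{(x_0,y)}(\omega)\to E_\alpha^{(x_0,y)}(\omega)\quad\text{as } n\to\infty,$$ uniformly for $\omega$ in compact subsets of $\mathbb{R}$. 2. $E_\alpha^{(x_0,y)}$ is a continuum limit of dual OPUC: let $\zeta_n$ be the $n$th standard approximant of $\zeta$ on $(x_0,y)$, let $\Delta_n=(y-x_0)/(n+1)$, and let $\Psi_n^*$ be the dual of the degree $n$ monic orthogonal polynomial on the unit circle with Verblunsky coefficients $-r_{\zeta_n}(x_0+j\Delta_n)$, $1\le j\le n$. Then $\mathcal{E}_{\zeta_n}^{(x_0,y)}(\omega)=\Psi_n^*(e^{2i\Delta_n\omega})$ for all $n\ge1$ and $\omega\in\mathbb{R}$, and $$\Psi_n^*(e^{2i\Delta_n\omega})\to E_\alpha^{(x_0,y)}(\omega)\quad\text{as } n\to\infty,$$ uniformly for $\omega$ in compact subsets of $\mathbb{R}$. -/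

import Mathlib

open Set Filter Topology MeasureTheory

noncomputable section

namespace HarmonicExponential

/-- `f : S → E` (with `S` an interval) is a step function: away from a finite set `F` of possible
jump points it is constant on every interval. The values at the points of `F` are arbitrary. -/
def IsStep {S : Set ℝ} {E : Type*} (f : S → E) : Prop :=
  ∃ F : Finset ℝ, ∀ a b : S, (∀ t ∈ F, t ∉ uIcc (a : ℝ) (b : ℝ)) → f a = f b

/-- `f` is regulated: a uniform limit of step functions. -/
def IsRegulated {S : Set ℝ} (f : S → ℝ) : Prop :=
  ∀ ε > 0, ∃ g : S → ℝ, IsStep g ∧ ∀ x, |f x - g x| ≤ ε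

/-- `ζ ∈ Step₊(X)`, `X = (x₀, x₁)`: strictly positive step functions. -/
structure IsStepPlus (x₀ x₁ : ℝ) (ζ : ℝ → ℝ) : Prop where
  step : IsStep fun x : Ioo x₀ x₁ => ζ x
  pos : ∀ x ∈ Ioo x₀ x₁, 0 < ζ x

/-- `ζ ∈ C¹₊(X)`, `X = (x₀, x₁)`: continuously differentiable regulated functions, bounded below
by a positive constant, whose derivative is also regulated. -/
structure IsC1Plus (x₀ x₁ : ℝ) (ζ : ℝ → ℝ) : Prop where
  contDiffOn : ContDiffOn ℝ 1 ζ (Ioo x₀ x₁)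
  regulated : IsRegulated fun x : Ioo x₀ x₁ => ζ x
  regulated_deriv : IsRegulated fun x : Ioo x₀ x₁ => deriv ζ x
  bddBelow : ∃ ε > 0, ∀ x ∈ Ioo x₀ x₁, ε < ζ x

theorem IsC1Plus.pos {x₀ x₁ : ℝ} {ζ : ℝ → ℝ} (h : IsC1Plus x₀ x₁ ζ) :
    ∀ x ∈ Ioo x₀ x₁, 0 < ζ x := by
  obtain ⟨ε, hε, H⟩ := h.bddBelow
  exact fun x hx => hε.trans (H x hx)

/-- `α = -ζ' / (2ζ)`. -/
def alpha (ζ : ℝ → ℝ) (x : ℝ) : ℝ := -deriv ζ x / (2 * ζ x)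

/-! ### The regular harmonic exponential -/

section Regular

variable {x₀ x₁ : ℝ} {α : ℝ → ℝ}

theorem integrable_kernel (hx : x₀ ≤ x₁) (hα : IntegrableOn α (Ioo x₀ x₁)) (ω : ℝ)
    (f : C(Icc x₀ x₁, ℂ)) :
    IntegrableOn (fun x : ℝ => (α x : ℂ) * Complex.exp (2 * Complex.I * (x - x₀) * ω) *
      (starRingEnd ℂ) (IccExtend hx f x)) (Icc x₀ x₁) := by
  have h0 : IntegrableOn (fun x : ℝ => (α x : ℂ)) (Icc x₀ x₁) := by
    rw [integrableOn_Icc_iff_integrableOn_Ioo]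
    exact hα.ofReal
  have hf : Continuous (fun x : ℝ => (starRingEnd ℂ) (IccExtend hx f x)) :=
    Complex.continuous_conj.comp (f.continuous.Icc_extend' (h := hx))
  have h1 : Continuous (fun x : ℝ => Complex.exp (2 * Complex.I * (x - x₀) * ω) *
      (starRingEnd ℂ) (IccExtend hx f x)) := by
    refine Continuous.mul ?_ hf
    fun_prop
  simpa only [mul_assoc] using h0.mul_continuousOn h1.continuousOn isCompact_Icc

theorem intervalIntegrable_kernel (hx : x₀ ≤ x₁) (hα : IntegrableOn α (Ioo x₀ x₁)) (ω : ℝ)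
    (f : C(Icc x₀ x₁, ℂ)) (y : Icc x₀ x₁) :
    IntervalIntegrable (fun x : ℝ => (α x : ℂ) * Complex.exp (2 * Complex.I * (x - x₀) * ω) *
      (starRingEnd ℂ) (IccExtend hx f x)) volume x₀ y := by
  rw [intervalIntegrable_iff_integrableOn_Ioc_of_le y.2.1]
  exact (integrable_kernel hx hα ω f).mono_set
    (Ioc_subset_Icc_self.trans (Icc_subset_Icc_right y.2.2))

theorem continuous_primitive_kernel (hx : x₀ ≤ x₁) (hα : IntegrableOn α (Ioo x₀ x₁)) (ω : ℝ)
    (f : C(Icc x₀ x₁, ℂ)) :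
    Continuous (fun y : Icc x₀ x₁ => ∫ x in x₀..(y : ℝ), (α x : ℂ) *
      Complex.exp (2 * Complex.I * (x - x₀) * ω) * (starRingEnd ℂ) (IccExtend hx f x)) := by
  have h := intervalIntegral.continuousOn_primitive_interval (μ := volume) (a := x₀) (b := x₁)
    (by rw [uIcc_of_le hx]; exact integrable_kernel hx hα ω f)
  rw [uIcc_of_le hx] at h
  exact continuousOn_iff_continuous_domRestrict.1 h

/-- The conjugate-linear (hence real-linear) Volterra operator `𝒜_ω` on `C([x₀, x₁])`,
`𝒜_ω f (y) = ∫_{x₀}^y α(x) e^{2i(x-x₀)ω} conj (f x) dx`, for `α ∈ L¹_ℝ(x₀, x₁)` and real `ω`. -/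
def opA (hx : x₀ ≤ x₁) (hα : IntegrableOn α (Ioo x₀ x₁)) (ω : ℝ) :
    Module.End ℝ C(Icc x₀ x₁, ℂ) where
  toFun f :=
    { toFun := fun y => ∫ x in x₀..(y : ℝ), (α x : ℂ) *
        Complex.exp (2 * Complex.I * (x - x₀) * ω) * (starRingEnd ℂ) (IccExtend hx f x)
      continuous_toFun := continuous_primitive_kernel hx hα ω f }
  map_add' f g := by
    ext y
    have h := intervalIntegral.integral_add (intervalIntegrable_kernel hx hα ω f y)
      (intervalIntegrable_kernel hx hα ω g y)
    refine Eq.trans ?_ h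
    refine congrArg (fun F : ℝ → ℂ => ∫ x in x₀..(y : ℝ), F x) ?_
    funext x
    simp only [IccExtend_apply, ContinuousMap.add_apply, map_add]
    ring
  map_smul' c f := by
    ext y
    refine Eq.trans ?_ (intervalIntegral.integral_const_mul (c : ℂ) (fun x : ℝ => (α x : ℂ) *
      Complex.exp (2 * Complex.I * (x - x₀) * ω) * (starRingEnd ℂ) (IccExtend hx f x)))
    refine congrArg (fun F : ℝ → ℂ => ∫ x in x₀..(y : ℝ), F x) ?_
    funext x
    simp only [IccExtend_apply, ContinuousMap.smul_apply, Complex.real_smul, map_mul,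
      Complex.conj_ofReal]
    ring

/-- The regular harmonic exponential `E_α^{(x₀,y)}(ω) = (1 - 𝒜_ω)⁻¹ 𝟙 (y)`, `x₀ ≤ y ≤ x₁`. -/
def regularExp (hx : x₀ ≤ x₁) (hα : IntegrableOn α (Ioo x₀ x₁)) (y : Icc x₀ x₁) (ω : ℝ) : ℂ :=
  (Ring.inverse (1 - opA hx hα ω) (1 : C(Icc x₀ x₁, ℂ))) y

end Regular

/-! ### The singular harmonic exponential -/

/-- Reflectivity `r(x) = (ζ(x-) - ζ(x+)) / (ζ(x-) + ζ(x+))`. -/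
def reflectivity (ζ : ℝ → ℝ) (x : ℝ) : ℝ :=
  (Function.leftLim ζ x - Function.rightLim ζ x) / (Function.leftLim ζ x + Function.rightLim ζ x)

section Singular

variable {x₀ x₁ : ℝ} {ζ : ℝ → ℝ}

theorem IsStepPlus.finite_support (hζ : IsStepPlus x₀ x₁ ζ) :
    ∃ F : Finset ℝ, ∀ x ∈ Ioo x₀ x₁, x ∉ F → reflectivity ζ x = 0 := by
  obtain ⟨F, hF⟩ := hζ.step
  refine ⟨F, fun x hx hxF => ?_⟩
  have hU : Ioo x₀ x₁ ∩ (F : Set ℝ)ᶜ ∈ 𝓝 x :=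
    inter_mem (Ioo_mem_nhds hx.1 hx.2) (F.finite_toSet.isClosed.isOpen_compl.mem_nhds hxF)
  obtain ⟨δ, hδ, hball⟩ := Metric.mem_nhds_iff.1 hU
  have hev : ζ =ᶠ[𝓝 x] fun _ => ζ x := by
    filter_upwards [Metric.ball_mem_nhds x hδ] with z hz
    refine hF ⟨z, (hball hz).1⟩ ⟨x, hx⟩ fun t ht htm => ?_
    have : t ∈ Metric.ball x δ :=
      (convex_ball x δ).ordConnected.uIcc_subset hz (Metric.mem_ball_self hδ) htm
    exact (hball this).2 ht
  have hc : ContinuousAt ζ x := (continuousAt_const (y := ζ x)).congr hev.symm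
  have hl : Function.leftLim ζ x = ζ x :=
    leftLim_eq_of_tendsto (hc.tendsto.mono_left nhdsWithin_le_nhds)
  have hr : Function.rightLim ζ x = ζ x :=
    rightLim_eq_of_tendsto (hc.tendsto.mono_left nhdsWithin_le_nhds)
  simp [reflectivity, hl, hr]

/-- Complex step functions, with a value at the right endpoint `x₁` included so that functions
`𝒵_ω f` can be evaluated at every `y ∈ (x₀, x₁]`. -/
def stepSpace (x₀ x₁ : ℝ) : Submodule ℝ (Ioc x₀ x₁ → ℂ) where
  carrier := {f | IsStep f}
  add_mem' := by
    classical
    rintro f g ⟨F, hF⟩ ⟨G, hG⟩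
    refine ⟨F ∪ G, fun a b h => ?_⟩
    simp only [Pi.add_apply]
    rw [hF a b fun t ht => h t (Finset.mem_union_left _ ht),
      hG a b fun t ht => h t (Finset.mem_union_right _ ht)]
  zero_mem' := ⟨∅, fun _ _ _ => rfl⟩
  smul_mem' := by
    rintro c f ⟨F, hF⟩
    exact ⟨F, fun a b h => by simp only [Pi.smul_apply]; rw [hF a b h]⟩

/-- The constant function `𝟙`. -/
def stepOne (x₀ x₁ : ℝ) : stepSpace x₀ x₁ := ⟨fun _ => 1, ∅, fun _ _ _ => rfl⟩

/-- The summand `r(x) e^{2i(x-x₀)ω} conj (f x)`. -/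
def opZTerm (x₀ x₁ : ℝ) (ζ : ℝ → ℝ) (ω : ℝ) (f : Ioc x₀ x₁ → ℂ) (x : Ioc x₀ x₁) : ℂ :=
  (reflectivity ζ x : ℂ) * Complex.exp (2 * Complex.I * ((x : ℝ) - x₀) * ω) * (starRingEnd ℂ) (f x)

theorem finite_opZTerm (hζ : IsStepPlus x₀ x₁ ζ) (ω : ℝ) (f : Ioc x₀ x₁ → ℂ) (y : Ioc x₀ x₁) :
    (Iio y ∩ Function.support (opZTerm x₀ x₁ ζ ω f)).Finite := by
  obtain ⟨F, hF⟩ := hζ.finite_support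
  refine (F.finite_toSet.preimage (Subtype.val_injective.injOn
    (s := ((↑) : Ioc x₀ x₁ → ℝ) ⁻¹' (F : Set ℝ)))).subset ?_
  rintro x ⟨hxy, hx⟩
  by_contra hxF
  refine hx ?_
  have : reflectivity ζ x = 0 :=
    hF x ⟨x.2.1, lt_of_lt_of_le (Subtype.coe_lt_coe.2 hxy) y.2.2⟩ hxF
  simp [opZTerm, this]

/-- The operator `𝒵_ω` on step functions, `𝒵_ω f (y) = ∑_{x₀<x<y} r(x) e^{2i(x-x₀)ω} conj (f x)`;
only the finitely many `x` with `r(x) ≠ 0` contribute. -/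
def opZ (hζ : IsStepPlus x₀ x₁ ζ) (ω : ℝ) : Module.End ℝ (stepSpace x₀ x₁) where
  toFun f :=
    ⟨fun y => ∑ᶠ x ∈ Iio y, opZTerm x₀ x₁ ζ ω f x, by
      obtain ⟨F, hF⟩ := hζ.finite_support
      refine ⟨F, fun a b hab => ?_⟩
      refine finsum_mem_inter_support_eq _ _ _ ?_
      have key : ∀ a b : Ioc x₀ x₁, (∀ t ∈ F, t ∉ uIcc (a : ℝ) (b : ℝ)) →
          Iio a ∩ Function.support (opZTerm x₀ x₁ ζ ω f) ⊆
            Iio b ∩ Function.support (opZTerm x₀ x₁ ζ ω f) := by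
        rintro a b hab x ⟨hxa, hx⟩
        refine ⟨?_, hx⟩
        by_contra hxb
        have h1 : (x : ℝ) < a := Subtype.coe_lt_coe.2 hxa
        have h2 : (b : ℝ) ≤ x := Subtype.coe_le_coe.2 (not_lt.1 hxb)
        have hxF : (x : ℝ) ∉ F := fun hm => hab x hm (mem_uIcc.2 (Or.inr ⟨h2, h1.le⟩))
        have : reflectivity ζ x = 0 := hF x ⟨x.2.1, h1.trans_le a.2.2⟩ hxF
        exact hx (by simp [opZTerm, this])
      exact Subset.antisymm (key a b hab) (key b a (by simpa only [uIcc_comm] using hab))⟩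
  map_add' f g := by
    ext y
    have h := finsum_mem_add_distrib' (finite_opZTerm hζ ω f y) (finite_opZTerm hζ ω g y)
    simp only [Submodule.coe_add, Pi.add_apply]
    rw [← h]
    refine finsum_mem_congr rfl fun x _ => ?_
    simp only [opZTerm, Pi.add_apply, map_add]
    ring
  map_smul' c f := by
    ext y
    simp only [Submodule.coe_smul, Pi.smul_apply, RingHom.id_apply]
    rw [smul_finsum]
    refine finsum_congr fun x => ?_
    rw [smul_finsum]
    refine finsum_congr fun _ => ?_
    simp only [opZTerm, Pi.smul_apply, Complex.real_smul, map_mul, Complex.conj_ofReal]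
    ring

/-- The singular harmonic exponential `𝓔_ζ^{(x₀,y)}(ω) = (1 - 𝒵_ω)⁻¹ 𝟙 (y)`, `x₀ < y ≤ x₁`. -/
def singularExp (hζ : IsStepPlus x₀ x₁ ζ) (y : Ioc x₀ x₁) (ω : ℝ) : ℂ :=
  (Ring.inverse (1 - opZ hζ ω) (stepOne x₀ x₁)).1 y

end Singular

/-! ### The standard approximation -/

/-- Spacing `Δ_n = (x₁ - x₀) / (n + 1)`. -/
def spacing (x₀ x₁ : ℝ) (n : ℕ) : ℝ := (x₁ - x₀) / (n + 1)

/-- The `n`th standard approximant on `(x₀, x₁)`: it takes the value `ζ(y_j + Δ_n/2)` on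
`[y_j, y_{j+1})`, where `y_j = x₀ + j Δ_n`; the index of the cell containing `x` is
`j = ⌊(x - x₀) / Δ_n⌋`. -/
def standardApprox (x₀ x₁ : ℝ) (ζ : ℝ → ℝ) (n : ℕ) (x : ℝ) : ℝ :=
  ζ (x₀ + ⌊(x - x₀) / spacing x₀ x₁ n⌋ * spacing x₀ x₁ n + spacing x₀ x₁ n / 2)

theorem spacing_pos {x₀ x₁ : ℝ} (hx : x₀ < x₁) (n : ℕ) : 0 < spacing x₀ x₁ n :=
  div_pos (sub_pos.2 hx) (by positivity)

theorem isStepPlus_standardApprox {x₀ x₁ : ℝ} {ζ : ℝ → ℝ} (hx : x₀ < x₁)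
    (hpos : ∀ x ∈ Ioo x₀ x₁, 0 < ζ x) (n : ℕ) :
    IsStepPlus x₀ x₁ (standardApprox x₀ x₁ ζ n) := by
  have hΔ := spacing_pos hx n
  have hΔn : ((n : ℝ) + 1) * spacing x₀ x₁ n = x₁ - x₀ := by
    unfold spacing; field_simp
  have hnn : ∀ x ∈ Ioo x₀ x₁, 0 ≤ ⌊(x - x₀) / spacing x₀ x₁ n⌋ := fun x hxx =>
    Int.floor_nonneg.2 (div_nonneg (sub_nonneg.2 hxx.1.le) hΔ.le)
  have hle : ∀ x ∈ Ioo x₀ x₁, ⌊(x - x₀) / spacing x₀ x₁ n⌋ ≤ n := by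
    intro x hxx
    refine Int.lt_add_one_iff.1 (Int.floor_lt.2 ?_)
    rw [div_lt_iff₀ hΔ]
    push_cast
    rw [hΔn]
    linarith [hxx.2]
  refine ⟨?_, fun x hxx => hpos _ ⟨?_, ?_⟩⟩
  · refine ⟨(Finset.range (n + 1)).image fun j : ℕ => x₀ + j * spacing x₀ x₁ n, ?_⟩
    have key : ∀ a b : Ioo x₀ x₁, (a : ℝ) ≤ b →
        (∀ t ∈ (Finset.range (n + 1)).image fun j : ℕ => x₀ + j * spacing x₀ x₁ n,
          t ∉ Icc (a : ℝ) (b : ℝ)) →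
        ⌊((a : ℝ) - x₀) / spacing x₀ x₁ n⌋ = ⌊((b : ℝ) - x₀) / spacing x₀ x₁ n⌋ := by
      intro a b hab h
      refine le_antisymm (Int.floor_mono (by gcongr)) ?_
      by_contra hlt
      rw [not_le] at hlt
      obtain ⟨k, hk⟩ := Int.eq_ofNat_of_zero_le (hnn b b.2)
      have hkn : k ≤ n := by have := hle b b.2; omega
      have h1 : (k : ℝ) ≤ ((b : ℝ) - x₀) / spacing x₀ x₁ n := by
        have := Int.floor_le (((b : ℝ) - x₀) / spacing x₀ x₁ n)
        rw [hk] at this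
        exact_mod_cast this
      have h2 : ((a : ℝ) - x₀) / spacing x₀ x₁ n < k := by
        rw [hk] at hlt
        have := Int.floor_lt.1 hlt
        exact_mod_cast this
      rw [le_div_iff₀ hΔ] at h1
      rw [div_lt_iff₀ hΔ] at h2
      exact h _ (Finset.mem_image.2 ⟨k, Finset.mem_range.2 (by omega), rfl⟩)
        ⟨by linarith, by linarith⟩
    intro a b h
    simp only [standardApprox]
    rcases le_total (a : ℝ) b with hab | hab
    · rw [key a b hab (by simpa only [uIcc_of_le hab] using h)]
    · rw [key b a hab (by simpa only [uIcc_of_ge hab] using h)]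
  · have h1 : (0 : ℝ) ≤ ⌊(x - x₀) / spacing x₀ x₁ n⌋ := by exact_mod_cast hnn x hxx
    nlinarith [mul_nonneg h1 hΔ.le]
  · have h1 : (⌊(x - x₀) / spacing x₀ x₁ n⌋ : ℝ) ≤ n := by exact_mod_cast hle x hxx
    nlinarith [mul_le_mul_of_nonneg_right h1 hΔ.le]

/-! ### Orthogonal polynomials on the unit circle -/

open Polynomial in
/-- The dual polynomial `P*(z) = zⁿ conj (P (1 / conj z))` of a polynomial of degree at most `n`:
conjugate the coefficients and reverse their order. -/
def dualPoly (n : ℕ) (P : ℂ[X]) : ℂ[X] := (P.map (starRingEnd ℂ)).reflect n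

open Polynomial in
/-- The monic orthogonal polynomials on the unit circle with Verblunsky coefficients
`a 1, a 2, …`, given by the Szegő recursion
`Φ_{n+1}(z) = z Φ_n(z) - conj (a_{n+1}) Φ_n*(z)`, `Φ_0 = 1`. The polynomial of degree `n` depends
only on `a 1, …, a n`. -/
def opuc (a : ℕ → ℂ) : ℕ → ℂ[X]
  | 0 => 1
  | n + 1 => X * opuc a n - C ((starRingEnd ℂ) (a (n + 1))) * dualPoly n (opuc a n)

/-- The dual OPUC `Ψ_n*` determined by the Verblunsky coefficients `-ρ_1, …, -ρ_n`, where
`ρ_j` is the reflectivity at `x₀ + jΔ_n` of the `n`th standard approximant of `ζ` on `(x₀, x₁)`. -/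
def dualPsi (x₀ x₁ : ℝ) (ζ : ℝ → ℝ) (n : ℕ) : Polynomial ℂ :=
  dualPoly n (opuc (fun j => -((reflectivity (standardApprox x₀ x₁ ζ n)
    (x₀ + j * spacing x₀ x₁ n) : ℝ) : ℂ)) n)

end HarmonicExponential

end

noncomputable section

namespace HarmonicExponential

/-! ### Regulated functions are bounded -/

/-! Both exponentials solve fixed-point equations: f = 1 + 𝒜_ω f is a Volterra equation, and its
singular counterpart is a finite recursion. The second is a one-step numerical scheme for the first,
and convergence is the usual "consistency plus stability".

Since ζ' is regulated it is bounded, say |ζ'| ≤ D. With ζ ≥ ε > 0 this gives |α| ≤ M = D/(2ε).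
Factorial bounds on the powers of 𝒜_ω make 1 - 𝒜_ω invertible and bound f, together with its
Lipschitz constant in y, uniformly in ω (`norm_regularFun_le`, `norm_regularFun_sub_le`). The
operator 𝒵_ω is nilpotent, and for a standard approximant its fixed-point equation becomes u_{j+1} =
u_j + r_{j+1} z^{j+1} conj u_j with z = e^{2iΔω} (`singularExp_standardApprox`). On |z| = 1 this is
exactly the Szegő recursion for the dual polynomials (`eval_dual_opuc`).

The reflectivity at a node is (ζ(p) - ζ(q))/(ζ(p) + ζ(q)), where p, q are the adjacent cell
midpoints; it approximates the integral of α over [p, q]. Hence one step of the recursion matches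
the increment of f from p to q up to O(Δ²) (`norm_step_sub_le`). A discrete Gronwall inequality with
growth factor 1 + MΔ turns this into a global error O(Δ), with a constant depending on ω only
through a bound for |ω| (`norm_singularExp_sub_regularExp_le`). Both limits follow, by taking the
approximant on (x₀, x₁) or on (x₀, y). -/

theorem IsStep.finite_range {S : Set ℝ} {E : Type*} [Zero E] {f : S → E} (hf : IsStep f) :
    (range f).Finite := by
  obtain ⟨F, hF⟩ := hf
  -- The key locates a among the points of F: the first set detects the gap, and the two together
  -- detect whether a itself lies in F. If a < b share a key, no point of F lies in [a, b], so f
  -- agrees at a and b; only finitely many keys exist.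
  let key : S → Finset ℝ × Finset ℝ := fun a =>
    (F.filter (· < (a : ℝ)), F.filter (· ≤ (a : ℝ)))
  have main : ∀ a b : S, (a : ℝ) ≤ b → key a = key b → f a = f b := by
    intro a b hab h
    obtain ⟨h1, h2⟩ := Prod.ext_iff.1 h
    by_cases heq : a = b
    · rw [heq]
    have hlt : (a : ℝ) < b := lt_of_le_of_ne hab fun h => heq (Subtype.ext h)
    refine hF a b fun t ht htm => ?_
    rw [uIcc_of_le hab] at htm
    have h3 : t ∈ F.filter (· ≤ (a : ℝ)) := by
      change t ∈ (key a).2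
      rw [h]
      exact Finset.mem_filter.2 ⟨ht, htm.2⟩
    have hta : t = a := le_antisymm (Finset.mem_filter.1 h3).2 htm.1
    have h4 : t ∈ F.filter (· < (a : ℝ)) := by
      change t ∈ (key a).1
      rw [h]
      exact Finset.mem_filter.2 ⟨ht, hta ▸ hlt⟩
    exact (Finset.mem_filter.1 h4).2.ne hta
  have hfac : f.FactorsThrough key := by
    intro a b h
    rcases le_total (a : ℝ) b with hab | hab
    · exact main a b hab h
    · exact (main b a hab h.symm).symm
  have hkey : (range key).Finite := by
    refine ((F.powerset ×ˢ F.powerset).finite_toSet).subset ?_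
    rintro _ ⟨a, rfl⟩
    exact Finset.mem_coe.2 (Finset.mem_product.2 ⟨Finset.mem_powerset.2 (Finset.filter_subset _ _),
      Finset.mem_powerset.2 (Finset.filter_subset _ _)⟩)
  refine (hkey.image (Function.extend key f 0)).subset ?_
  rintro _ ⟨a, rfl⟩
  exact ⟨key a, ⟨a, rfl⟩, hfac.extend_apply 0 a⟩

theorem IsRegulated.exists_bound {S : Set ℝ} {f : S → ℝ} (hf : IsRegulated f) :
    ∃ D, ∀ x, |f x| ≤ D := by
  obtain ⟨g, hg, hfg⟩ := hf 1 one_pos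
  obtain ⟨B, hB⟩ := (hg.finite_range.image abs).bddAbove
  refine ⟨1 + B, fun x => ?_⟩
  have h1 : |g x| ≤ B := hB ⟨g x, ⟨x, rfl⟩, rfl⟩
  have h2 := abs_sub_abs_le_abs_sub (f x) (g x)
  linarith [hfg x]

/-! ### Uniform bounds for ζ, ζ' and α, and integrability of α -/

theorem IsC1Plus.continuousOn_deriv {x₀ x₁ : ℝ} {ζ : ℝ → ℝ} (h : IsC1Plus x₀ x₁ ζ) :
    ContinuousOn (deriv ζ) (Ioo x₀ x₁) :=
  h.contDiffOn.continuousOn_deriv_of_isOpen isOpen_Ioo le_rfl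

theorem IsC1Plus.continuousOn_alpha {x₀ x₁ : ℝ} {ζ : ℝ → ℝ} (h : IsC1Plus x₀ x₁ ζ) :
    ContinuousOn (alpha ζ) (Ioo x₀ x₁) :=
  h.continuousOn_deriv.neg.div (continuousOn_const.mul h.contDiffOn.continuousOn)
    fun x hx => (mul_pos two_pos (h.pos x hx)).ne'

/-- Lower bound of `ζ` and bound of `ζ'`. -/
structure C1Bounds (x₀ x₁ : ℝ) (ζ : ℝ → ℝ) (ε D : ℝ) : Prop where
  eps_pos : 0 < ε
  D_nonneg : 0 ≤ D
  lower : ∀ x ∈ Ioo x₀ x₁, ε ≤ ζ x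
  deriv_le : ∀ x ∈ Ioo x₀ x₁, |deriv ζ x| ≤ D

theorem IsC1Plus.exists_bounds {x₀ x₁ : ℝ} {ζ : ℝ → ℝ} (h : IsC1Plus x₀ x₁ ζ) :
    ∃ ε D, C1Bounds x₀ x₁ ζ ε D := by
  obtain ⟨ε, hε, hl⟩ := h.bddBelow
  obtain ⟨D, hD⟩ := h.regulated_deriv.exists_bound
  exact ⟨ε, max D 0, hε, le_max_right _ _, fun x hx => (hl x hx).le,
    fun x hx => (hD ⟨x, hx⟩).trans (le_max_left _ _)⟩

theorem C1Bounds.abs_alpha_le {x₀ x₁ : ℝ} {ζ : ℝ → ℝ} {ε D : ℝ} (h : C1Bounds x₀ x₁ ζ ε D)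
    {x : ℝ} (hx : x ∈ Ioo x₀ x₁) : |alpha ζ x| ≤ D / (2 * ε) := by
  have h1 := h.lower x hx
  have h0 := h.eps_pos
  rw [alpha, abs_div, abs_neg, abs_of_pos (by linarith : 0 < 2 * ζ x)]
  exact div_le_div₀ h.D_nonneg (h.deriv_le x hx) (by linarith) (by linarith)

theorem IsC1Plus.integrableOn_alpha {x₀ x₁ : ℝ} {ζ : ℝ → ℝ} (h : IsC1Plus x₀ x₁ ζ) :
    IntegrableOn (alpha ζ) (Ioo x₀ x₁) := by
  obtain ⟨ε, D, hb⟩ := h.exists_bounds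
  refine IntegrableOn.of_bound (C := D / (2 * ε)) (by simp)
    (h.continuousOn_alpha.aestronglyMeasurable measurableSet_Ioo) ?_
  exact (ae_restrict_mem measurableSet_Ioo).mono fun x hx => hb.abs_alpha_le hx

/-! ### The phase factor -/

theorem norm_phase (x x₀ ω : ℝ) : ‖Complex.exp (2 * Complex.I * (x - x₀) * ω)‖ = 1 := by
  have : (2 * Complex.I * (x - x₀) * ω : ℂ) = ((2 * (x - x₀) * ω : ℝ) : ℂ) * Complex.I := by
    push_cast; ring
  rw [this, Complex.norm_exp_ofReal_mul_I]

theorem norm_phase_sub_le (x c x₀ ω : ℝ) :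
    ‖Complex.exp (2 * Complex.I * (c - x₀) * ω) - Complex.exp (2 * Complex.I * (x - x₀) * ω)‖ ≤
      2 * |ω| * |c - x| := by
  have : Complex.exp (2 * Complex.I * (c - x₀) * ω) - Complex.exp (2 * Complex.I * (x - x₀) * ω) =
      Complex.exp (2 * Complex.I * (x - x₀) * ω) *
        (Complex.exp (Complex.I * ((2 * ω * (c - x) : ℝ) : ℂ)) - 1) := by
    rw [mul_sub _ (Complex.exp _), ← Complex.exp_add, mul_one]
    congr 2
    push_cast; ring
  rw [this, norm_mul, norm_phase, one_mul]
  refine Real.norm_exp_I_mul_ofReal_sub_one_le.trans ?_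
  rw [Real.norm_eq_abs, abs_mul, abs_mul, abs_two]

/-! ### The regular harmonic exponential -/

section Regular

variable {x₀ x₁ : ℝ} {α : ℝ → ℝ}

/-- The integrand of `𝒜_ω f`. -/
def kernelA (hx : x₀ ≤ x₁) (α : ℝ → ℝ) (ω : ℝ) (f : C(Icc x₀ x₁, ℂ)) (x : ℝ) : ℂ :=
  (α x : ℂ) * Complex.exp (2 * Complex.I * (x - x₀) * ω) * (starRingEnd ℂ) (IccExtend hx f x)

theorem opA_apply (hx : x₀ ≤ x₁) (hα : IntegrableOn α (Ioo x₀ x₁)) (ω : ℝ)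
    (f : C(Icc x₀ x₁, ℂ)) (y : Icc x₀ x₁) :
    opA hx hα ω f y = ∫ x in x₀..(y : ℝ), kernelA hx α ω f x := rfl

theorem norm_kernelA (hx : x₀ ≤ x₁) (α : ℝ → ℝ) (ω : ℝ) (f : C(Icc x₀ x₁, ℂ)) {x : ℝ}
    (h : x ∈ Icc x₀ x₁) : ‖kernelA hx α ω f x‖ = |α x| * ‖f ⟨x, h⟩‖ := by
  rw [kernelA, norm_mul, norm_mul, norm_phase, mul_one, RCLike.norm_conj, Complex.norm_real,
    Real.norm_eq_abs, IccExtend_of_mem hx f h]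

theorem norm_opA_apply_le (hx : x₀ ≤ x₁) (hα : IntegrableOn α (Ioo x₀ x₁)) {M : ℝ}
    (hM : ∀ x ∈ Ioo x₀ x₁, |α x| ≤ M) (ω : ℝ) (f : C(Icc x₀ x₁, ℂ)) {g : ℝ → ℝ}
    (hg : Continuous g) (hfg : ∀ x, ‖f x‖ ≤ g x) (y : Icc x₀ x₁) :
    ‖opA hx hα ω f y‖ ≤ ∫ x in x₀..(y : ℝ), M * g x := by
  rw [opA_apply]
  refine intervalIntegral.norm_integral_le_of_norm_le y.2.1 ?_
    (hg.const_mul M).continuousOn.intervalIntegrable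
  -- The bound on α holds only on the open interval, so the endpoint x₁ is discarded as a null set.
  filter_upwards [(countable_singleton x₁).ae_notMem volume] with x hne hxy
  have hx1 : x < x₁ := lt_of_le_of_ne (hxy.2.trans y.2.2) hne
  rw [norm_kernelA hx α ω f ⟨hxy.1.le, hx1.le⟩]
  exact mul_le_mul (hM x ⟨hxy.1, hx1⟩) (hfg _) (norm_nonneg _)
    ((abs_nonneg _).trans (hM x ⟨hxy.1, hx1⟩))

/-- The Volterra estimate: each application integrates the previous bound against M from x₀ to y,
which produces the next term of the exponential series. -/
theorem norm_opA_pow_apply_le (hx : x₀ ≤ x₁) (hα : IntegrableOn α (Ioo x₀ x₁)) {M : ℝ}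
    (hM : ∀ x ∈ Ioo x₀ x₁, |α x| ≤ M) (ω : ℝ) (f : C(Icc x₀ x₁, ℂ)) (k : ℕ) (y : Icc x₀ x₁) :
    ‖(opA hx hα ω ^ k) f y‖ ≤ ‖f‖ * ((M * (y - x₀)) ^ k / k.factorial) := by
  induction k generalizing y with
  | zero => simpa using f.norm_coe_le_norm y
  | succ k ih =>
    rw [pow_succ', Module.End.mul_apply]
    refine (norm_opA_apply_le hx hα hM ω _
      (g := fun x => ‖f‖ * ((M * (x - x₀)) ^ k / k.factorial)) (by fun_prop) ih y).trans_eq ?_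
    have h1 : (fun x : ℝ => M * (‖f‖ * ((M * (x - x₀)) ^ k / k.factorial))) =
        fun x : ℝ => (‖f‖ * M ^ (k + 1) / k.factorial) * (x - x₀) ^ k := by
      funext x
      rw [mul_pow]
      ring
    rw [h1, intervalIntegral.integral_const_mul,
      intervalIntegral.integral_comp_sub_right (fun x => x ^ k), integral_pow, Nat.factorial_succ]
    have h2 : (k.factorial : ℝ) ≠ 0 := by positivity
    have h3 : (k + 1 : ℝ) ≠ 0 := by positivity
    push_cast
    rw [mul_pow]
    field_simp
    simp

/-- Neumann series for an endomorphism whose powers have summable bounds. -/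
theorem isUnit_one_sub_of_summable {V : Type*} [NormedAddCommGroup V] [NormedSpace ℝ V]
    [CompleteSpace V] (T : Module.End ℝ V) {c : ℕ → ℝ} (hc : Summable c) (hc0 : ∀ k, 0 ≤ c k)
    (hT : ∀ k v, ‖(T ^ k) v‖ ≤ c k * ‖v‖) : IsUnit (1 - T) := by
  -- The case k = 1 of the bounds makes T continuous. The Neumann series is then summed in operator
  -- norm, and the unit is carried back along the ring homomorphism to plain endomorphisms.
  obtain ⟨A, hA⟩ : ∃ A : V →L[ℝ] V, ContinuousLinearMap.toLinearMapRingHom A = T :=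
    ⟨T.mkContinuous (c 1) fun v => by simpa using hT 1 v, rfl⟩
  have hApow : ∀ k, ‖A ^ k‖ ≤ c k := fun k =>
    ContinuousLinearMap.opNorm_le_bound _ (hc0 k) fun v => by
      have : (A ^ k) v = (T ^ k) v := by
        rw [← hA, ← map_pow]; rfl
      rw [this]
      exact hT k v
  have hs : Summable (A ^ ·) := Summable.of_norm_bounded hc hApow
  have hu : IsUnit (1 - A) :=
    ⟨⟨1 - A, ∑' k, A ^ k, hs.one_sub_mul_tsum_pow, hs.tsum_pow_mul_one_sub⟩, rfl⟩
  have := hu.map (ContinuousLinearMap.toLinearMapRingHom (R₁ := ℝ) (M₁ := V))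
  rwa [map_sub, map_one, hA] at this

theorem isUnit_one_sub_opA (hx : x₀ ≤ x₁) (hα : IntegrableOn α (Ioo x₀ x₁)) {M : ℝ}
    (hM0 : 0 ≤ M) (hM : ∀ x ∈ Ioo x₀ x₁, |α x| ≤ M) (ω : ℝ) : IsUnit (1 - opA hx hα ω) := by
  have h0 : 0 ≤ M * (x₁ - x₀) := mul_nonneg hM0 (sub_nonneg.2 hx)
  refine isUnit_one_sub_of_summable _ (Real.summable_pow_div_factorial (M * (x₁ - x₀)))
    (fun k => by positivity) fun k f => ?_
  rw [ContinuousMap.norm_le _ (by positivity)]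
  intro y
  refine (norm_opA_pow_apply_le hx hα hM ω f k y).trans ?_
  rw [mul_comm]
  have h1 : 0 ≤ (y : ℝ) - x₀ := sub_nonneg.2 y.2.1
  have h2 : (y : ℝ) ≤ x₁ := y.2.2
  gcongr

/-- The function `y ↦ E_α^{(x₀,y)}(ω)`. -/
def regularFun (hx : x₀ ≤ x₁) (hα : IntegrableOn α (Ioo x₀ x₁)) (ω : ℝ) : C(Icc x₀ x₁, ℂ) :=
  Ring.inverse (1 - opA hx hα ω) 1

/-- Invertibility is needed because `Ring.inverse` takes the value 0 at non-units. -/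
theorem regularFun_eq (hx : x₀ ≤ x₁) (hα : IntegrableOn α (Ioo x₀ x₁)) {ω : ℝ}
    (hu : IsUnit (1 - opA hx hα ω)) :
    regularFun hx hα ω = 1 + opA hx hα ω (regularFun hx hα ω) := by
  have h : ((1 - opA hx hα ω) * Ring.inverse (1 - opA hx hα ω)) 1 = 1 := by
    rw [Ring.mul_inverse_cancel _ hu]; rfl
  rw [Module.End.mul_apply, LinearMap.sub_apply, Module.End.one_apply] at h
  exact sub_eq_iff_eq_add.1 h

/-- A Volterra equation `f = 1 + 𝒜_ω f` forces a bound independent of `ω`. -/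
theorem norm_regularFun_le (hx : x₀ ≤ x₁) (hα : IntegrableOn α (Ioo x₀ x₁)) {M : ℝ}
    (hM0 : 0 ≤ M) (hM : ∀ x ∈ Ioo x₀ x₁, |α x| ≤ M) (ω : ℝ) (y : Icc x₀ x₁) :
    ‖regularFun hx hα ω y‖ ≤ Real.exp (M * (x₁ - x₀)) := by
  set A := opA hx hα ω with hA
  set f := regularFun hx hα ω with hf
  have hfix : f = 1 + A f := regularFun_eq hx hα (isUnit_one_sub_opA hx hα hM0 hM ω)
  have hL : 0 ≤ M * (x₁ - x₀) := mul_nonneg hM0 (sub_nonneg.2 hx)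
  have hmono : ∀ k : ℕ, (M * (y - x₀)) ^ k / k.factorial ≤ (M * (x₁ - x₀)) ^ k / k.factorial := by
    intro k
    have h1 : 0 ≤ (y : ℝ) - x₀ := sub_nonneg.2 y.2.1
    have h2 : (y : ℝ) ≤ x₁ := y.2.2
    gcongr
  -- Iterating f = 1 + A f. The sum is dominated by partial sums of the exponential series, and the
  -- remainder, at most ‖f‖ times a term of that series, vanishes as k → ∞.
  have hiter : ∀ k : ℕ, f = (∑ i ∈ Finset.range k, (A ^ i) 1) + (A ^ k) f := by
    intro k
    induction k with
    | zero => simp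
    | succ k ih =>
      rw [Finset.sum_range_succ, add_assoc, pow_succ, Module.End.mul_apply, ← map_add, ← hfix]
      exact ih
  have hone : ‖(1 : C(Icc x₀ x₁, ℂ))‖ ≤ 1 := by
    rw [ContinuousMap.norm_le _ zero_le_one]; simp
  have hb : ∀ k : ℕ, ‖f y‖ ≤
      Real.exp (M * (x₁ - x₀)) + ‖f‖ * ((M * (x₁ - x₀)) ^ k / k.factorial) := by
    intro k
    conv_lhs => rw [hiter k]
    rw [ContinuousMap.add_apply, ContinuousMap.sum_apply]
    refine (norm_add_le _ _).trans (add_le_add ?_ ?_)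
    · refine (norm_sum_le _ _).trans (le_trans (Finset.sum_le_sum fun i _ => ?_)
        (Real.sum_le_exp_of_nonneg hL k))
      refine (norm_opA_pow_apply_le hx hα hM ω 1 i y).trans ?_
      calc _ ≤ 1 * ((M * (x₁ - x₀)) ^ i / i.factorial) :=
            mul_le_mul hone (hmono i) (by
              have h1 : 0 ≤ (y : ℝ) - x₀ := sub_nonneg.2 y.2.1
              positivity) zero_le_one
        _ = _ := one_mul _
    · exact (norm_opA_pow_apply_le hx hα hM ω f k y).trans
        (mul_le_mul_of_nonneg_left (hmono k) (norm_nonneg _))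
  have hlim := ((FloorSemiring.tendsto_pow_div_factorial_atTop (M * (x₁ - x₀))).const_mul
    ‖f‖).const_add (Real.exp (M * (x₁ - x₀)))
  rw [mul_zero, add_zero] at hlim
  exact ge_of_tendsto' hlim hb

theorem regularFun_left (hx : x₀ ≤ x₁) (hα : IntegrableOn α (Ioo x₀ x₁)) {ω : ℝ}
    (hu : IsUnit (1 - opA hx hα ω)) : regularFun hx hα ω ⟨x₀, left_mem_Icc.2 hx⟩ = 1 := by
  rw [regularFun_eq hx hα hu, ContinuousMap.add_apply, opA_apply]
  simp

theorem regularFun_sub (hx : x₀ ≤ x₁) (hα : IntegrableOn α (Ioo x₀ x₁)) {ω : ℝ}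
    (hu : IsUnit (1 - opA hx hα ω)) (p q : Icc x₀ x₁) :
    regularFun hx hα ω q - regularFun hx hα ω p =
      ∫ x in (p : ℝ)..q, kernelA hx α ω (regularFun hx hα ω) x := by
  conv_lhs => rw [regularFun_eq hx hα hu]
  rw [ContinuousMap.add_apply, ContinuousMap.add_apply, opA_apply, opA_apply,
    ContinuousMap.one_apply, ContinuousMap.one_apply, add_sub_add_left_eq_sub]
  exact intervalIntegral.integral_interval_sub_left
    (intervalIntegrable_kernel hx hα ω _ q) (intervalIntegrable_kernel hx hα ω _ p)

/-- The increment is the integral of a kernel bounded by M times the a priori bound on f, so the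
Lipschitz constant does not depend on ω. -/
theorem norm_regularFun_sub_le (hx : x₀ ≤ x₁) (hα : IntegrableOn α (Ioo x₀ x₁)) {M : ℝ}
    (hM0 : 0 ≤ M) (hM : ∀ x ∈ Ioo x₀ x₁, |α x| ≤ M) (ω : ℝ) (p q : Icc x₀ x₁) :
    ‖regularFun hx hα ω q - regularFun hx hα ω p‖ ≤
      M * Real.exp (M * (x₁ - x₀)) * |(q : ℝ) - p| := by
  rw [regularFun_sub hx hα (isUnit_one_sub_opA hx hα hM0 hM ω)]
  refine intervalIntegral.norm_integral_le_of_norm_le_const_ae ?_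
  filter_upwards [(countable_singleton x₁).ae_notMem volume,
    (countable_singleton x₀).ae_notMem volume] with x hne hne' hxy
  have hmem : x ∈ Icc x₀ x₁ := ordConnected_Icc.uIcc_subset p.2 q.2 (uIoc_subset_uIcc hxy)
  have hmem' : x ∈ Ioo x₀ x₁ :=
    ⟨lt_of_le_of_ne hmem.1 (Ne.symm hne'), lt_of_le_of_ne hmem.2 hne⟩
  rw [norm_kernelA hx α ω _ hmem]
  exact mul_le_mul (hM x hmem') (norm_regularFun_le hx hα hM0 hM ω _) (norm_nonneg _) hM0

end Regular

/-! ### The singular harmonic exponential -/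

theorem opZ_apply {x₀ x₁ : ℝ} {ζ : ℝ → ℝ} (hζ : IsStepPlus x₀ x₁ ζ) (ω : ℝ)
    (f : stepSpace x₀ x₁) (y : Ioc x₀ x₁) :
    (opZ hζ ω f).1 y = ∑ᶠ x ∈ Iio y, opZTerm x₀ x₁ ζ ω f x := rfl

/-- The sum defining 𝒵_ω f(y) runs over x strictly below y, so each application uses up a jump
point: 𝒵_ω^k f vanishes at y as soon as fewer than k points of F precede y. -/
theorem isNilpotent_opZ {x₀ x₁ : ℝ} {ζ : ℝ → ℝ} (hζ : IsStepPlus x₀ x₁ ζ) (ω : ℝ) :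
    IsNilpotent (opZ hζ ω) := by
  obtain ⟨F, hF⟩ := hζ.finite_support
  have main : ∀ (k : ℕ) (f : stepSpace x₀ x₁) (y : Ioc x₀ x₁),
      (F.filter (· < (y : ℝ))).card < k → ((opZ hζ ω ^ k) f).1 y = 0 := by
    intro k
    induction k with
    | zero => intro f y h; exact absurd h (Nat.not_lt_zero _)
    | succ k ih =>
      intro f y h
      rw [pow_succ', Module.End.mul_apply, opZ_apply]
      refine finsum_mem_eq_zero_of_forall_eq_zero fun x hxy => ?_
      have hxy' : (x : ℝ) < y := Subtype.coe_lt_coe.2 hxy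
      by_cases hxF : (x : ℝ) ∈ F
      · have hcard : (F.filter (· < (x : ℝ))).card < (F.filter (· < (y : ℝ))).card := by
          refine Finset.card_lt_card (Finset.ssubset_iff_of_subset ?_ |>.2
            ⟨x, Finset.mem_filter.2 ⟨hxF, hxy'⟩, fun h => (Finset.mem_filter.1 h).2.false⟩)
          intro t ht
          rw [Finset.mem_filter] at ht ⊢
          exact ⟨ht.1, ht.2.trans hxy'⟩
        rw [opZTerm, ih f x (by omega), map_zero, mul_zero]
      · simp [opZTerm, hF x ⟨x.2.1, hxy'.trans_le y.2.2⟩ hxF]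
  refine ⟨F.card + 1, LinearMap.ext fun f => Subtype.ext (funext fun y => ?_)⟩
  exact main _ f y (Nat.lt_succ_of_le (Finset.card_filter_le _ _))

theorem isUnit_one_sub_opZ {x₀ x₁ : ℝ} {ζ : ℝ → ℝ} (hζ : IsStepPlus x₀ x₁ ζ) (ω : ℝ) :
    IsUnit (1 - opZ hζ ω) :=
  IsNilpotent.isUnit_one_sub (R := Module.End ℝ (stepSpace x₀ x₁)) (isNilpotent_opZ hζ ω)

theorem singularExp_eq {x₀ x₁ : ℝ} {ζ : ℝ → ℝ} (hζ : IsStepPlus x₀ x₁ ζ) (y : Ioc x₀ x₁) (ω : ℝ) :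
    singularExp hζ y ω =
      1 + ∑ᶠ x ∈ Iio y, opZTerm x₀ x₁ ζ ω (fun y => singularExp hζ y ω) x := by
  have h : ((1 - opZ hζ ω) * Ring.inverse (1 - opZ hζ ω)) (stepOne x₀ x₁) = stepOne x₀ x₁ := by
    rw [Ring.mul_inverse_cancel _ (isUnit_one_sub_opZ hζ ω)]; rfl
  rw [Module.End.mul_apply, LinearMap.sub_apply, Module.End.one_apply] at h
  exact congrArg (fun g : stepSpace x₀ x₁ => g.1 y) (sub_eq_iff_eq_add.1 h)

/-! ### Jumps of the standard approximant -/

section Jumps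

variable {x₀ b : ℝ} {ζ : ℝ → ℝ} {n : ℕ}

theorem standardApprox_of_mem_cell (hb : x₀ < b) {k : ℕ} {x : ℝ}
    (h1 : x₀ + k * spacing x₀ b n ≤ x) (h2 : x < x₀ + (k + 1) * spacing x₀ b n) :
    standardApprox x₀ b ζ n x = ζ (x₀ + k * spacing x₀ b n + spacing x₀ b n / 2) := by
  have hΔ := spacing_pos hb n
  have : ⌊(x - x₀) / spacing x₀ b n⌋ = (k : ℤ) := by
    rw [Int.floor_eq_iff, le_div_iff₀ hΔ, div_lt_iff₀ hΔ]
    push_cast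
    constructor <;> linarith
  rw [standardApprox, this, Int.cast_natCast]

theorem leftLim_standardApprox (hb : x₀ < b) {k : ℕ} {x : ℝ}
    (h1 : x₀ + k * spacing x₀ b n < x) (h2 : x ≤ x₀ + (k + 1) * spacing x₀ b n) :
    Function.leftLim (standardApprox x₀ b ζ n) x =
      ζ (x₀ + k * spacing x₀ b n + spacing x₀ b n / 2) := by
  refine leftLim_eq_of_tendsto (tendsto_const_nhds.congr' ?_)
  filter_upwards [Ioo_mem_nhdsLT h1] with z hz
  exact (standardApprox_of_mem_cell hb hz.1.le (hz.2.trans_le h2)).symm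

theorem rightLim_standardApprox (hb : x₀ < b) {k : ℕ} {x : ℝ}
    (h1 : x₀ + k * spacing x₀ b n ≤ x) (h2 : x < x₀ + (k + 1) * spacing x₀ b n) :
    Function.rightLim (standardApprox x₀ b ζ n) x =
      ζ (x₀ + k * spacing x₀ b n + spacing x₀ b n / 2) := by
  refine rightLim_eq_of_tendsto (tendsto_const_nhds.congr' ?_)
  filter_upwards [Ioo_mem_nhdsGT h2] with z hz
  exact (standardApprox_of_mem_cell hb (h1.trans hz.1.le) hz.2).symm

theorem reflectivity_standardApprox_interior (hb : x₀ < b) {k : ℕ} {x : ℝ}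
    (h1 : x₀ + k * spacing x₀ b n < x) (h2 : x < x₀ + (k + 1) * spacing x₀ b n) :
    reflectivity (standardApprox x₀ b ζ n) x = 0 := by
  rw [reflectivity, leftLim_standardApprox hb h1 h2.le, rightLim_standardApprox hb h1.le h2,
    sub_self, zero_div]

/-- The midpoint of the `k`th cell. -/
def midpt (x₀ b : ℝ) (n k : ℕ) : ℝ := x₀ + k * spacing x₀ b n + spacing x₀ b n / 2

theorem reflectivity_standardApprox_node (hb : x₀ < b) (k : ℕ) :
    reflectivity (standardApprox x₀ b ζ n) (x₀ + (k + 1 : ℕ) * spacing x₀ b n) =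
      (ζ (midpt x₀ b n k) - ζ (midpt x₀ b n (k + 1))) /
        (ζ (midpt x₀ b n k) + ζ (midpt x₀ b n (k + 1))) := by
  have hΔ := spacing_pos hb n
  rw [reflectivity, leftLim_standardApprox (k := k) hb (by push_cast; linarith) (by push_cast; rfl),
    rightLim_standardApprox (k := k + 1) hb le_rfl (by linarith)]
  rfl

/-- These cells are closed on the right, unlike those of the approximant, to match the strict
inequality x < y in 𝒵_ω: a node equal to y does not contribute at y. Hence the ceiling instead of
the floor. -/
theorem exists_cell (hb : x₀ < b) (n : ℕ) {x : ℝ} (hx : x₀ < x) :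
    ∃ k : ℕ, x₀ + k * spacing x₀ b n < x ∧ x ≤ x₀ + (k + 1) * spacing x₀ b n := by
  have hΔ := spacing_pos hb n
  have ht : 0 < (x - x₀) / spacing x₀ b n := div_pos (sub_pos.2 hx) hΔ
  obtain ⟨k, hk⟩ := Nat.exists_eq_succ_of_ne_zero (Nat.ceil_pos.2 ht).ne'
  have h1 := Nat.ceil_lt_add_one ht.le
  have h2 := Nat.le_ceil ((x - x₀) / spacing x₀ b n)
  rw [hk, Nat.succ_eq_add_one, Nat.cast_add, Nat.cast_one] at h1 h2
  rw [add_lt_add_iff_right, lt_div_iff₀ hΔ] at h1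
  rw [div_le_iff₀ hΔ] at h2
  exact ⟨k, by linarith, by linarith⟩

end Jumps

/-! ### The Szegő recursion on the unit circle -/

/-- The recursion `u_{j+1} = u_j + r_{j+1} z^{j+1} conj u_j`, `u_0 = 1`. -/
def szegoSeq (r : ℕ → ℂ) (z : ℂ) : ℕ → ℂ
  | 0 => 1
  | j + 1 => szegoSeq r z j + r (j + 1) * z ^ (j + 1) * (starRingEnd ℂ) (szegoSeq r z j)

theorem szegoSeq_eq_sum (r : ℕ → ℂ) (z : ℂ) (k : ℕ) :
    szegoSeq r z k = 1 + ∑ j ∈ Finset.range k,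
      r (j + 1) * z ^ (j + 1) * (starRingEnd ℂ) (szegoSeq r z j) := by
  induction k with
  | zero => simp [szegoSeq]
  | succ k ih => rw [Finset.sum_range_succ, ← add_assoc, ← ih, szegoSeq]

/-- Reflectivities of the standard approximant at its nodes. -/
def nodeRefl (x₀ b : ℝ) (ζ : ℝ → ℝ) (n j : ℕ) : ℂ :=
  (reflectivity (standardApprox x₀ b ζ n) (x₀ + j * spacing x₀ b n) : ℝ)

/-- For y in the k-th right-closed cell exactly the k nodes y_1, …, y_k lie below y, and
reflectivity vanishes off the nodes. The node y_{j+1} itself belongs to cell j, so strong induction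
identifies the value there with the j-th term of the recursion. -/
theorem singularExp_standardApprox {x₀ b : ℝ} {ζ : ℝ → ℝ} (hb : x₀ < b) {n : ℕ}
    (hζ : IsStepPlus x₀ b (standardApprox x₀ b ζ n)) (ω : ℝ) {k : ℕ} {y : Ioc x₀ b}
    (h1 : x₀ + k * spacing x₀ b n < y) (h2 : (y : ℝ) ≤ x₀ + (k + 1) * spacing x₀ b n) :
    singularExp hζ y ω = szegoSeq (nodeRefl x₀ b ζ n)
      (Complex.exp (2 * Complex.I * spacing x₀ b n * ω)) k := by
  have hΔ := spacing_pos hb n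
  induction k using Nat.strong_induction_on generalizing y with
  | _ k ih =>
    have hnode : ∀ j : Fin k, x₀ + ((j : ℕ) + 1 : ℕ) * spacing x₀ b n ∈ Ioc x₀ b ∧
        x₀ + ((j : ℕ) + 1 : ℕ) * spacing x₀ b n < y := by
      intro j
      have hj : (((j : ℕ) + 1 : ℕ) : ℝ) ≤ k := by exact_mod_cast j.2
      have h3 := mul_le_mul_of_nonneg_right hj hΔ.le
      have h4 : 0 < (((j : ℕ) + 1 : ℕ) : ℝ) * spacing x₀ b n := by positivity
      exact ⟨⟨by linarith, by linarith [y.2.2]⟩, by linarith⟩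
    let node : Fin k → Ioc x₀ b := fun j => ⟨_, (hnode j).1⟩
    have hinj : Function.Injective node := by
      intro i j hij
      have h3 : x₀ + (((i : ℕ) + 1 : ℕ) : ℝ) * spacing x₀ b n =
        x₀ + (((j : ℕ) + 1 : ℕ) : ℝ) * spacing x₀ b n := congrArg Subtype.val hij
      have h4 := mul_right_cancel₀ hΔ.ne' (add_left_cancel h3)
      exact Fin.ext (by have := Nat.cast_injective (R := ℝ) h4; omega)
    rw [singularExp_eq, szegoSeq_eq_sum]
    congr 1
    -- The set of all x < y may be replaced by the set of nodes, as the two meet the support of the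
    -- summand in the same set; the second bullet proves this.
    rw [finsum_mem_inter_support_eq (t := range node), finsum_mem_range hinj,
      finsum_eq_sum_of_fintype, ← Fin.sum_univ_eq_sum_range
        (fun j => nodeRefl x₀ b ζ n (j + 1) * Complex.exp (2 * Complex.I * spacing x₀ b n * ω) ^
          (j + 1) * (starRingEnd ℂ) (szegoSeq (nodeRefl x₀ b ζ n)
            (Complex.exp (2 * Complex.I * spacing x₀ b n * ω)) j))]
    · refine Finset.sum_congr rfl fun j _ => ?_
      have h3 := ih j j.2 (y := node j)
        (by simp only [node]; push_cast; linarith) (by simp only [node]; push_cast; rfl)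
      rw [opZTerm, h3, nodeRefl, ← Complex.exp_nat_mul]
      simp only [node]
      congr 3
      push_cast
      ring
    · refine Subset.antisymm (fun x hx => ⟨?_, hx.2⟩) (fun x hx => ⟨?_, hx.2⟩)
      · obtain ⟨i, hi1, hi2⟩ := exists_cell hb n x.2.1
        rcases hi2.lt_or_eq with hlt | heq
        · exact absurd (by rw [opZTerm, reflectivity_standardApprox_interior hb hi1 hlt]; simp) hx.2
        · have hxy : (x : ℝ) < y := Subtype.coe_lt_coe.2 hx.1
          have hik : (i : ℝ) < k := by
            have : ((i : ℝ) + 1) * spacing x₀ b n < (k + 1) * spacing x₀ b n := by linarith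
            have := lt_of_mul_lt_mul_right this hΔ.le
            linarith
          exact ⟨⟨i, by exact_mod_cast hik⟩, Subtype.ext (by simp only [node]; push_cast; exact heq.symm)⟩
      · obtain ⟨j, rfl⟩ := hx.1
        exact Subtype.coe_lt_coe.1 (show ((node j : Ioc x₀ b) : ℝ) < y from (hnode j).2)

open Polynomial in
theorem natDegree_dualPoly_le {n : ℕ} {P : ℂ[X]} (h : P.natDegree ≤ n) :
    (dualPoly n P).natDegree ≤ n :=
  natDegree_reflect_le.trans (max_le le_rfl (natDegree_map_le.trans h))

open Polynomial in
theorem natDegree_opuc_le (a : ℕ → ℂ) (n : ℕ) : (opuc a n).natDegree ≤ n := by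
  induction n with
  | zero => simp [opuc]
  | succ n ih =>
    rw [opuc]
    refine (natDegree_sub_le _ _).trans (max_le ?_ ?_)
    · exact natDegree_mul_le.trans (by have := natDegree_X_le (R := ℂ); omega)
    · exact (natDegree_C_mul_le _ _).trans ((natDegree_dualPoly_le ih).trans n.le_succ)

open Polynomial in
-- On the unit circle conj z is the inverse of z, so the reversal identity for polynomials, taken at
-- conj z, gives the value at z.
theorem eval_dualPoly {z : ℂ} (hz : ‖z‖ = 1) {n : ℕ} {P : ℂ[X]} (h : P.natDegree ≤ n) :
    (dualPoly n P).eval z = z ^ n * (starRingEnd ℂ) (P.eval z) := by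
  have hzz : z * (starRingEnd ℂ) z = 1 := by
    rw [Complex.mul_conj, Complex.normSq_eq_norm_sq, hz]; simp
  let _ : Invertible ((starRingEnd ℂ) z) := ⟨z, hzz, (mul_comm _ _).trans hzz⟩
  have key := eval₂_reflect_mul_pow (RingHom.id ℂ) ((starRingEnd ℂ) z) n (P.map (starRingEnd ℂ))
    (natDegree_map_le.trans h)
  have h2 : eval₂ (RingHom.id ℂ) ((starRingEnd ℂ) z) (P.map (starRingEnd ℂ)) =
      (starRingEnd ℂ) (P.eval z) := by
    rw [eval₂_id, eval_map, eval₂_at_apply]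
  have h1 : (dualPoly n P).eval z * ((starRingEnd ℂ) z) ^ n = (starRingEnd ℂ) (P.eval z) := by
    rw [← h2, ← key, eval₂_id]
    rfl
  rw [← h1, mul_left_comm, ← mul_pow, hzz, one_pow, mul_one]

open Polynomial in
-- Applying w ↦ z^{n+1} conj w to the Szegő recursion and using z conj z = 1 gives Φ*_{n+1} = Φ*_n -
-- a_{n+1} z^{n+1} conj Φ*_n, a recursion in the dual polynomials alone.
theorem eval_dual_opuc (a : ℕ → ℂ) {z : ℂ} (hz : ‖z‖ = 1) (n : ℕ) :
    (dualPoly n (opuc a n)).eval z = szegoSeq (fun j => -a j) z n := by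
  have hzz : z * (starRingEnd ℂ) z = 1 := by
    rw [Complex.mul_conj, Complex.normSq_eq_norm_sq, hz]; simp
  induction n with
  | zero => rw [eval_dualPoly hz (natDegree_opuc_le a 0)]; simp [opuc, szegoSeq]
  | succ n ih =>
    rw [eval_dualPoly hz (natDegree_opuc_le a _), szegoSeq, ← ih, opuc, eval_sub, eval_mul,
      eval_mul, eval_X, eval_C, map_sub, map_mul, map_mul, Complex.conj_conj]
    nth_rewrite 2 [eval_dualPoly hz (natDegree_opuc_le a n)]
    linear_combination (z ^ n * (starRingEnd ℂ) ((opuc a n).eval z)) * hzz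

theorem norm_exp_phase (s ω : ℝ) : ‖Complex.exp (2 * Complex.I * s * ω)‖ = 1 := by
  simpa using norm_phase s 0 ω

theorem eval_dualPsi (x₀ b : ℝ) (ζ : ℝ → ℝ) (n : ℕ) (ω : ℝ) :
    (dualPsi x₀ b ζ n).eval (Complex.exp (2 * Complex.I * spacing x₀ b n * ω)) =
      szegoSeq (nodeRefl x₀ b ζ n) (Complex.exp (2 * Complex.I * spacing x₀ b n * ω)) n := by
  rw [dualPsi, eval_dual_opuc _ (norm_exp_phase _ _)]
  simp only [neg_neg]
  rfl

/-! ### Comparison of the two exponentials -/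

section Compare

variable {x₀ x₁ : ℝ} {ζ : ℝ → ℝ} {ε D : ℝ}

theorem C1Bounds.M_nonneg (hb : C1Bounds x₀ x₁ ζ ε D) : 0 ≤ D / (2 * ε) :=
  div_nonneg hb.D_nonneg (mul_pos two_pos hb.eps_pos).le

theorem C1Bounds.abs_sub_le (hb : C1Bounds x₀ x₁ ζ ε D) (hζ : IsC1Plus x₀ x₁ ζ) {p q : ℝ}
    (hp : p ∈ Ioo x₀ x₁) (hq : q ∈ Ioo x₀ x₁) : |ζ q - ζ p| ≤ D * |q - p| :=
  (convex_Ioo x₀ x₁).norm_image_sub_le_of_norm_deriv_le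
    (fun _ hx => (hζ.contDiffOn.differentiableOn one_ne_zero).differentiableAt
      (isOpen_Ioo.mem_nhds hx)) hb.deriv_le hp hq

/-- The mean value inequality bounds the numerator and 2ε bounds the denominator below. The
resulting constant is the same M = D/(2ε) that bounds |α|. -/
theorem C1Bounds.abs_reflection_le (hb : C1Bounds x₀ x₁ ζ ε D) (hζ : IsC1Plus x₀ x₁ ζ) {p q : ℝ}
    (hp : p ∈ Ioo x₀ x₁) (hq : q ∈ Ioo x₀ x₁) :
    |(ζ p - ζ q) / (ζ p + ζ q)| ≤ D / (2 * ε) * |q - p| := by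
  have h1 := hb.lower p hp
  have h2 := hb.lower q hq
  have h0 := hb.eps_pos
  rw [abs_div, abs_of_pos (by linarith : 0 < ζ p + ζ q), div_mul_eq_mul_div, abs_sub_comm]
  exact div_le_div₀ (mul_nonneg hb.D_nonneg (abs_nonneg _)) (hb.abs_sub_le hζ hp hq)
    (by linarith) (by linarith)

/-- The constant in the local error estimate, for frequencies at most `W`. -/
def errConst (x₀ x₁ ε D W : ℝ) : ℝ :=
  D * (Real.exp (D / (2 * ε) * (x₁ - x₀)) * (D / (2 * ε ^ 2)) +
    (2 * W * Real.exp (D / (2 * ε) * (x₁ - x₀)) +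
      D / (2 * ε) * Real.exp (D / (2 * ε) * (x₁ - x₀))) / (2 * ε))

theorem errConst_nonneg (hb : C1Bounds x₀ x₁ ζ ε D) {W : ℝ} (hW : 0 ≤ W) :
    0 ≤ errConst x₀ x₁ ε D W := by
  have := hb.D_nonneg
  have := hb.eps_pos
  unfold errConst
  positivity

/-- One step of the singular recursion, taken from the regular exponential at `p`, agrees with the
regular exponential at `q` to second order. -/
theorem norm_step_sub_le (hx : x₀ ≤ x₁) (hζ : IsC1Plus x₀ x₁ ζ) (hb : C1Bounds x₀ x₁ ζ ε D)
    (hα : IntegrableOn (alpha ζ) (Ioo x₀ x₁)) {W ω : ℝ} (hω : |ω| ≤ W) {p q c : ℝ}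
    (hp : p ∈ Ioo x₀ x₁) (hq : q ∈ Ioo x₀ x₁) (hpc : p ≤ c) (hcq : c ≤ q) :
    ‖(((ζ p - ζ q) / (ζ p + ζ q) : ℝ) : ℂ) * Complex.exp (2 * Complex.I * (c - x₀) * ω) *
        (starRingEnd ℂ) (regularFun hx hα ω ⟨p, Ioo_subset_Icc_self hp⟩) -
      (regularFun hx hα ω ⟨q, Ioo_subset_Icc_self hq⟩ -
        regularFun hx hα ω ⟨p, Ioo_subset_Icc_self hp⟩)‖ ≤
      errConst x₀ x₁ ε D W * (q - p) ^ 2 := by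
  have hM0 := hb.M_nonneg
  have hM : ∀ x ∈ Ioo x₀ x₁, |alpha ζ x| ≤ D / (2 * ε) := fun x h => hb.abs_alpha_le h
  have hε := hb.eps_pos
  have hD := hb.D_nonneg
  set M := D / (2 * ε) with hMdef
  set C := Real.exp (M * (x₁ - x₀)) with hC
  have hC0 : 0 < C := Real.exp_pos _
  set f := regularFun hx hα ω with hf
  have hpq : p ≤ q := hpc.trans hcq
  have hsub : Icc p q ⊆ Ioo x₀ x₁ := fun x h => ⟨hp.1.trans_le h.1, h.2.trans_lt hq.2⟩
  set e : ℝ → ℂ := fun x => Complex.exp (2 * Complex.I * (x - x₀) * ω) with he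
  set S := ζ p + ζ q with hS
  have hS1 : 2 * ε ≤ S := by linarith [hb.lower p hp, hb.lower q hq]
  have hS0 : 0 < S := by linarith
  set P : ℂ := e c * (starRingEnd ℂ) (f ⟨p, Ioo_subset_Icc_self hp⟩) with hP
  have hdint : IntervalIntegrable (fun x => deriv ζ x) volume p q :=
    (hζ.continuousOn_deriv.mono (by rwa [uIcc_of_le hpq])).intervalIntegrable
  have hFTC : ∫ x in p..q, deriv ζ x = ζ q - ζ p :=
    intervalIntegral.integral_deriv_eq_sub (fun x hxm =>
      (hζ.contDiffOn.differentiableOn one_ne_zero).differentiableAt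
        (isOpen_Ioo.mem_nhds (hsub (by rwa [uIcc_of_le hpq] at hxm)))) hdint
  have hkint : IntervalIntegrable (kernelA hx (alpha ζ) ω f) volume p q :=
    (intervalIntegrable_kernel hx hα ω f ⟨p, Ioo_subset_Icc_self hp⟩).symm.trans
      (intervalIntegrable_kernel hx hα ω f ⟨q, Ioo_subset_Icc_self hq⟩)
  -- Writing ζ(p) - ζ(q) as an integral of -ζ' puts the discrete step and the increment of f under
  -- one integral over [p, q]. It then suffices that the difference of integrands is O(q - p).
  have h1 : (((ζ p - ζ q) / S : ℝ) : ℂ) * e c *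
      (starRingEnd ℂ) (f ⟨p, Ioo_subset_Icc_self hp⟩) =
      ∫ x in p..q, ((deriv ζ x : ℝ) : ℂ) * (-P / S) := by
    rw [intervalIntegral.integral_mul_const, intervalIntegral.integral_ofReal, hFTC, hP]
    push_cast
    ring
  rw [regularFun_sub hx hα (isUnit_one_sub_opA hx hα hM0 hM ω), ← hf]
  change ‖(((ζ p - ζ q) / S : ℝ) : ℂ) * e c *
      (starRingEnd ℂ) (f ⟨p, Ioo_subset_Icc_self hp⟩) - _‖ ≤ _
  have hdint' : IntervalIntegrable (fun x => ((deriv ζ x : ℝ) : ℂ) * (-P / S)) volume p q :=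
    (show IntervalIntegrable (fun x => ((deriv ζ x : ℝ) : ℂ)) volume p q from
      ⟨hdint.1.ofReal, hdint.2.ofReal⟩).mul_const _
  rw [h1, ← intervalIntegral.integral_sub hdint' hkint]
  have hbound : ∀ x ∈ uIoc p q, ‖((deriv ζ x : ℝ) : ℂ) * (-P / S) - kernelA hx (alpha ζ) ω f x‖ ≤
      errConst x₀ x₁ ε D W * (q - p) := by
    intro x hxm
    have hxI : x ∈ Icc p q := by
      rw [uIoc_of_le hpq] at hxm; exact Ioc_subset_Icc_self hxm
    have hxX := hsub hxI
    have hT1 : 2 * ε ≤ 2 * ζ x := by linarith [hb.lower x hxX]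
    have hT0 : 0 < 2 * ζ x := by linarith
    set Q : ℂ := e x * (starRingEnd ℂ) (f ⟨x, Ioo_subset_Icc_self hxX⟩) with hQ
    have hPn : ‖P‖ ≤ C := by
      rw [hP, norm_mul, norm_phase, one_mul, RCLike.norm_conj]
      exact norm_regularFun_le hx hα hM0 hM ω _
    -- The first term comes from moving the phase from c to x, the second from the Lipschitz bound
    -- on f between p and x.
    have hPQ : ‖P - Q‖ ≤ (2 * W * C + M * C) * (q - p) := by
      have hdec : P - Q = (e c - e x) * (starRingEnd ℂ) (f ⟨p, Ioo_subset_Icc_self hp⟩) +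
          e x * (starRingEnd ℂ) (f ⟨p, Ioo_subset_Icc_self hp⟩ -
            f ⟨x, Ioo_subset_Icc_self hxX⟩) := by
        rw [hP, hQ, map_sub]; ring
      have hcx : |c - x| ≤ q - p := by
        rw [abs_le]; constructor <;> linarith [hxI.1, hxI.2]
      have hpx : |p - x| ≤ q - p := by
        rw [abs_le]; constructor <;> linarith [hxI.1, hxI.2]
      rw [hdec, add_mul]
      refine (norm_add_le _ _).trans (add_le_add ?_ ?_)
      · rw [norm_mul, RCLike.norm_conj]
        calc ‖e c - e x‖ * ‖f ⟨p, Ioo_subset_Icc_self hp⟩‖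
            ≤ (2 * W * (q - p)) * C := by
              refine mul_le_mul ((norm_phase_sub_le x c x₀ ω).trans ?_)
                (norm_regularFun_le hx hα hM0 hM ω _) (norm_nonneg _)
                (mul_nonneg (by linarith [abs_nonneg ω]) (by linarith))
              exact mul_le_mul (by linarith) hcx (abs_nonneg _) (by linarith [abs_nonneg ω])
          _ = 2 * W * C * (q - p) := by ring
      · rw [norm_mul, norm_phase, one_mul, RCLike.norm_conj]
        exact (norm_regularFun_sub_le hx hα hM0 hM ω _ _).trans
          (mul_le_mul_of_nonneg_left hpx (by positivity))
    have hinv : |1 / (2 * ζ x) - 1 / S| ≤ D / (2 * ε ^ 2) * (q - p) := by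
      have h2 : 1 / (2 * ζ x) - 1 / S = ((ζ p - ζ x) + (ζ q - ζ x)) / (2 * ζ x * S) := by
        rw [div_sub_div _ _ hT0.ne' hS0.ne', hS]
        congr 1
        ring
      have h3 : |(ζ p - ζ x) + (ζ q - ζ x)| ≤ 2 * D * (q - p) := by
        refine (abs_add_le _ _).trans ?_
        have h4 := hb.abs_sub_le hζ hxX hp
        have h5 := hb.abs_sub_le hζ hxX hq
        rw [abs_of_nonpos (by linarith [hxI.1] : p - x ≤ 0)] at h4
        rw [abs_of_nonneg (by linarith [hxI.2] : 0 ≤ q - x)] at h5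
        have h6 := mul_nonneg hD (sub_nonneg.2 hpq)
        nlinarith
      rw [h2, abs_div, abs_of_pos (mul_pos hT0 hS0)]
      calc _ ≤ 2 * D * (q - p) / ((2 * ε) * (2 * ε)) :=
            div_le_div₀ (by have := sub_nonneg.2 hpq; positivity) h3 (by positivity)
              (mul_le_mul hT1 hS1 (by positivity) hT0.le)
        _ = _ := by field_simp
    -- Both integrands carry the same factor ζ'(x), so only the bound |ζ'| ≤ D is needed and no
    -- modulus of continuity of ζ' enters.
    have hsplit : ((deriv ζ x : ℝ) : ℂ) * (-P / S) - kernelA hx (alpha ζ) ω f x =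
        ((deriv ζ x : ℝ) : ℂ) * (P * ((1 / (2 * ζ x) - 1 / S : ℝ) : ℂ) -
          (P - Q) * ((1 / (2 * ζ x) : ℝ) : ℂ)) := by
      have h7 : kernelA hx (alpha ζ) ω f x = ((alpha ζ x : ℝ) : ℂ) * Q := by
        rw [kernelA, IccExtend_of_mem hx f (Ioo_subset_Icc_self hxX), hQ, mul_assoc]
      rw [h7, alpha]
      push_cast
      ring
    rw [hsplit, norm_mul, Complex.norm_real, Real.norm_eq_abs]
    have h8 : ‖P * ((1 / (2 * ζ x) - 1 / S : ℝ) : ℂ) - (P - Q) * ((1 / (2 * ζ x) : ℝ) : ℂ)‖ ≤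
        C * (D / (2 * ε ^ 2) * (q - p)) + (2 * W * C + M * C) * (q - p) * (1 / (2 * ε)) := by
      refine (norm_sub_le _ _).trans (add_le_add ?_ ?_)
      · rw [norm_mul, Complex.norm_real, Real.norm_eq_abs]
        exact mul_le_mul hPn hinv (abs_nonneg _) hC0.le
      · rw [norm_mul, Complex.norm_real, Real.norm_eq_abs, abs_of_pos (by positivity)]
        exact mul_le_mul hPQ (one_div_le_one_div_of_le (by positivity) hT1) (by positivity)
          ((norm_nonneg _).trans hPQ)
    calc _ ≤ D * (C * (D / (2 * ε ^ 2) * (q - p)) +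
          (2 * W * C + M * C) * (q - p) * (1 / (2 * ε))) :=
          mul_le_mul (hb.deriv_le x hxX) h8 (norm_nonneg _) hD
      _ = _ := by rw [errConst, ← hMdef, ← hC]; ring
  refine (intervalIntegral.norm_integral_le_of_norm_le_const hbound).trans_eq ?_
  rw [abs_of_nonneg (sub_nonneg.2 hpq)]
  ring

/-! ### Propagation of the error along the midpoints -/

theorem midpt_mem_Ioo {b : ℝ} (hb : x₀ < b) {n k : ℕ} (hk : k ≤ n) :
    midpt x₀ b n k ∈ Ioo x₀ b := by
  have hΔ := spacing_pos hb n
  have h1 : ((n : ℝ) + 1) * spacing x₀ b n = b - x₀ := by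
    unfold spacing; field_simp
  have h2 : (k : ℝ) * spacing x₀ b n ≤ n * spacing x₀ b n :=
    mul_le_mul_of_nonneg_right (by exact_mod_cast hk) hΔ.le
  have h3 : 0 ≤ (k : ℝ) * spacing x₀ b n := by positivity
  rw [midpt]
  constructor <;> linarith

theorem midpt_succ (x₀ b : ℝ) (n k : ℕ) :
    midpt x₀ b n (k + 1) = midpt x₀ b n k + spacing x₀ b n := by
  simp only [midpt]; push_cast; ring

/-- Solution of a linear recursive inequality. -/
theorem le_of_discrete_gronwall {w : ℕ → ℝ} {a c : ℝ} (ha : 0 ≤ a) (hc : 0 ≤ c) {n : ℕ}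
    (h : ∀ k < n, w (k + 1) ≤ (1 + a) * w k + c) {k : ℕ} (hk : k ≤ n) :
    w k ≤ (1 + a) ^ k * (w 0 + k * c) := by
  induction k with
  | zero => simp
  | succ k ih =>
    have h1 := ih (by omega)
    have h2 := h k (by omega)
    have h3 : c ≤ (1 + a) ^ (k + 1) * c :=
      le_mul_of_one_le_left hc (one_le_pow₀ (by linarith))
    have h4 := mul_le_mul_of_nonneg_left h1 (by linarith : 0 ≤ 1 + a)
    push_cast
    rw [pow_succ] at h3 ⊢
    linarith

/-- The constant in the global error estimate. -/
def globalConst (x₀ x₁ ε D W : ℝ) : ℝ :=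
  Real.exp (D / (2 * ε) * (x₁ - x₀)) *
    (D / (2 * ε) * Real.exp (D / (2 * ε) * (x₁ - x₀)) + (x₁ - x₀) * errConst x₀ x₁ ε D W) +
    D / (2 * ε) * Real.exp (D / (2 * ε) * (x₁ - x₀))

/-- The comparison is made at midpoints, not nodes, because the reflectivity at a node involves ζ at
the two neighbouring midpoints. At most (x₁ - x₀)/Δ local errors of size O(Δ²), amplified by at most
an exponential, add up to O(Δ). -/
theorem norm_szegoSeq_sub_regularFun_le (hx : x₀ ≤ x₁) (hζ : IsC1Plus x₀ x₁ ζ)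
    (hb : C1Bounds x₀ x₁ ζ ε D) (hα : IntegrableOn (alpha ζ) (Ioo x₀ x₁)) {W ω : ℝ}
    (hω : |ω| ≤ W) {b : ℝ} (h0b : x₀ < b) (hb1 : b ≤ x₁) {n k : ℕ} (hk : k ≤ n) :
    ‖szegoSeq (nodeRefl x₀ b ζ n) (Complex.exp (2 * Complex.I * spacing x₀ b n * ω)) k -
      regularFun hx hα ω ⟨midpt x₀ b n k,
        Ioo_subset_Icc_self (Ioo_subset_Ioo_right hb1 (midpt_mem_Ioo h0b hk))⟩‖ ≤
      Real.exp (D / (2 * ε) * (x₁ - x₀)) *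
        (D / (2 * ε) * Real.exp (D / (2 * ε) * (x₁ - x₀)) + (x₁ - x₀) * errConst x₀ x₁ ε D W) *
        spacing x₀ b n := by
  have hM0 := hb.M_nonneg
  have hM : ∀ x ∈ Ioo x₀ x₁, |alpha ζ x| ≤ D / (2 * ε) := fun x h => hb.abs_alpha_le h
  have hK := errConst_nonneg hb ((abs_nonneg ω).trans hω)
  have hΔ := spacing_pos h0b n
  set M := D / (2 * ε)
  set C := Real.exp (M * (x₁ - x₀)) with hC
  set K := errConst x₀ x₁ ε D W
  set Δ := spacing x₀ b n with hΔdef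
  set f := regularFun hx hα ω with hf
  set z := Complex.exp (2 * Complex.I * Δ * ω) with hz
  set u := szegoSeq (nodeRefl x₀ b ζ n) z
  have hmid : ∀ {j : ℕ}, j ≤ n → midpt x₀ b n j ∈ Ioo x₀ x₁ := fun hj =>
    Ioo_subset_Ioo_right hb1 (midpt_mem_Ioo h0b hj)
  -- The extension of f makes w total; for j > n the midpoint may leave the interval.
  let w : ℕ → ℝ := fun j => ‖u j - IccExtend hx f (midpt x₀ b n j)‖
  have hw : ∀ {j : ℕ} (hj : j ≤ n),
      w j = ‖u j - f ⟨midpt x₀ b n j, Ioo_subset_Icc_self (hmid hj)⟩‖ := fun hj => by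
    simp only [w, IccExtend_of_mem hx f (Ioo_subset_Icc_self (hmid hj))]
  have hstep : ∀ j < n, w (j + 1) ≤ (1 + M * Δ) * w j + K * Δ ^ 2 := by
    intro j hj
    rw [hw hj, hw hj.le]
    have hp := hmid hj.le
    have hq := hmid (Nat.succ_le_of_lt hj)
    have hqp : midpt x₀ b n (j + 1) - midpt x₀ b n j = Δ := by rw [midpt_succ]; ring
    set p := midpt x₀ b n j with hpdef
    set q := midpt x₀ b n (j + 1) with hqdef
    have hs := norm_step_sub_le hx hζ hb hα hω hp hq (c := x₀ + (j + 1 : ℕ) * Δ)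
      (by rw [hpdef, midpt, ← hΔdef]; push_cast; linarith)
      (by rw [hqdef, midpt, ← hΔdef]; linarith)
    have hr := hb.abs_reflection_le hζ hp hq
    rw [hqp] at hs hr
    rw [abs_of_pos hΔ] at hr
    have hphase : Complex.exp (2 * Complex.I * ((x₀ + (j + 1 : ℕ) * Δ : ℝ) - x₀) * ω) =
        z ^ (j + 1) := by
      rw [hz, ← Complex.exp_nat_mul]
      congr 1
      push_cast
      ring
    rw [hphase] at hs
    have hnr : nodeRefl x₀ b ζ n (j + 1) = (((ζ p - ζ q) / (ζ p + ζ q) : ℝ) : ℂ) := by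
      rw [nodeRefl, reflectivity_standardApprox_node h0b]
    have hu : u (j + 1) = u j + (((ζ p - ζ q) / (ζ p + ζ q) : ℝ) : ℂ) * z ^ (j + 1) *
        (starRingEnd ℂ) (u j) := by
      rw [← hnr]; rfl
    -- The three terms are the previous error, its reflection (at most MΔ times as large), and the
    -- local error of one step started from the exact value at p.
    have hdec : u (j + 1) - f ⟨q, Ioo_subset_Icc_self hq⟩ =
        (u j - f ⟨p, Ioo_subset_Icc_self hp⟩) +
        (((ζ p - ζ q) / (ζ p + ζ q) : ℝ) : ℂ) * z ^ (j + 1) *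
          (starRingEnd ℂ) (u j - f ⟨p, Ioo_subset_Icc_self hp⟩) +
        ((((ζ p - ζ q) / (ζ p + ζ q) : ℝ) : ℂ) * z ^ (j + 1) *
          (starRingEnd ℂ) (f ⟨p, Ioo_subset_Icc_self hp⟩) -
          (f ⟨q, Ioo_subset_Icc_self hq⟩ - f ⟨p, Ioo_subset_Icc_self hp⟩)) := by
      rw [hu, map_sub]; ring
    rw [hdec, add_mul, one_mul]
    refine (norm_add₃_le).trans (add_le_add (add_le_add le_rfl ?_) hs)
    rw [norm_mul, norm_mul, norm_pow, hz, norm_exp_phase, one_pow, mul_one, RCLike.norm_conj,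
      Complex.norm_real, Real.norm_eq_abs]
    exact mul_le_mul_of_nonneg_right hr (norm_nonneg _)
  have hw0 : w 0 ≤ M * C * Δ := by
    rw [hw n.zero_le]
    have hu0 : u 0 = f ⟨x₀, left_mem_Icc.2 hx⟩ :=
      (regularFun_left hx hα (isUnit_one_sub_opA hx hα hM0 hM ω)).symm
    rw [hu0]
    refine (norm_regularFun_sub_le hx hα hM0 hM ω _ _).trans
      (mul_le_mul_of_nonneg_left ?_ (by positivity))
    simp only [midpt, ← hΔdef]
    rw [abs_le]
    constructor <;> push_cast <;> linarith
  have hg := le_of_discrete_gronwall (mul_nonneg hM0 hΔ.le) (by positivity) hstep hk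
  rw [← hw hk]
  have hkΔ : (k : ℝ) * Δ ≤ x₁ - x₀ := by
    have h1 := (midpt_mem_Ioo h0b hk).2
    rw [midpt, ← hΔdef] at h1
    linarith
  have hpow : (1 + M * Δ) ^ k ≤ C := by
    calc (1 + M * Δ) ^ k ≤ Real.exp (M * Δ) ^ k := by
          refine pow_le_pow_left₀ (by positivity) ?_ k
          linarith [Real.add_one_le_exp (M * Δ)]
      _ = Real.exp (M * (k * Δ)) := by rw [← Real.exp_nat_mul]; ring_nf
      _ ≤ C := Real.exp_le_exp.2 (mul_le_mul_of_nonneg_left hkΔ hM0)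
  refine hg.trans ?_
  rw [mul_assoc]
  refine mul_le_mul hpow ?_ (add_nonneg (norm_nonneg _) (by positivity)) (Real.exp_pos _).le
  have h5 : (k : ℝ) * (K * Δ ^ 2) ≤ (x₁ - x₀) * K * Δ := by
    have := mul_le_mul_of_nonneg_right hkΔ (mul_nonneg hK hΔ.le)
    linarith
  rw [add_mul]
  exact add_le_add hw0 h5

/-- Singular and regular exponentials differ by a multiple of the spacing. -/
theorem norm_singularExp_sub_regularExp_le (hx : x₀ ≤ x₁) (hζ : IsC1Plus x₀ x₁ ζ)
    (hb : C1Bounds x₀ x₁ ζ ε D) (hα : IntegrableOn (alpha ζ) (Ioo x₀ x₁)) {W ω : ℝ}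
    (hω : |ω| ≤ W) {b : ℝ} (h0b : x₀ < b) (hb1 : b ≤ x₁) {n : ℕ}
    (hs : IsStepPlus x₀ b (standardApprox x₀ b ζ n)) {y : ℝ} (hy : y ∈ Ioc x₀ b) :
    ‖singularExp hs ⟨y, hy⟩ ω - regularExp hx hα ⟨y, hy.1.le, hy.2.trans hb1⟩ ω‖ ≤
      globalConst x₀ x₁ ε D W * spacing x₀ b n := by
  have hM0 := hb.M_nonneg
  have hM : ∀ x ∈ Ioo x₀ x₁, |alpha ζ x| ≤ D / (2 * ε) := fun x h => hb.abs_alpha_le h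
  have hΔ := spacing_pos h0b n
  obtain ⟨k, hk1, hk2⟩ := exists_cell h0b n hy.1
  have hk : k ≤ n := by
    have h1 : ((n : ℝ) + 1) * spacing x₀ b n = b - x₀ := by
      unfold spacing; field_simp
    have h2 : (k : ℝ) * spacing x₀ b n < (n + 1) * spacing x₀ b n := by linarith [hy.2]
    have h3 : (k : ℝ) < n + 1 := lt_of_mul_lt_mul_right h2 hΔ.le
    exact Nat.lt_succ_iff.1 (by exact_mod_cast h3)
  rw [singularExp_standardApprox h0b hs ω hk1 hk2]
  have h4 := norm_szegoSeq_sub_regularFun_le hx hζ hb hα hω h0b hb1 hk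
  have h5 := norm_regularFun_sub_le hx hα hM0 hM ω ⟨y, hy.1.le, hy.2.trans hb1⟩
    ⟨midpt x₀ b n k, Ioo_subset_Icc_self (Ioo_subset_Ioo_right hb1 (midpt_mem_Ioo h0b hk))⟩
  have h6 : |midpt x₀ b n k - y| ≤ spacing x₀ b n := by
    rw [midpt, abs_le]
    constructor <;> linarith
  have h7 := h5.trans (mul_le_mul_of_nonneg_left h6 (mul_nonneg hM0 (Real.exp_pos _).le))
  rw [globalConst, add_mul]
  exact (norm_sub_le_norm_sub_add_norm_sub _ _ _).trans (add_le_add h4 h7)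

theorem tendsto_spacing (x₀ b : ℝ) : Tendsto (spacing x₀ b) atTop (𝓝 0) :=
  tendsto_const_div_atTop_nhds_zero_nat (b - x₀) |>.comp (tendsto_add_atTop_nat 1) |>.congr
    fun n => by simp [spacing]

theorem tendstoUniformlyOn_singularExp (hx : x₀ ≤ x₁) (hζ : IsC1Plus x₀ x₁ ζ)
    (hα : IntegrableOn (alpha ζ) (Ioo x₀ x₁)) {b : ℝ} (h0b : x₀ < b) (hb1 : b ≤ x₁)
    (hs : ∀ n, IsStepPlus x₀ b (standardApprox x₀ b ζ n)) {y : ℝ} (hy : y ∈ Ioc x₀ b)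
    {K : Set ℝ} (hK : IsCompact K) :
    TendstoUniformlyOn (fun (n : ℕ) (ω : ℝ) => singularExp (hs n) ⟨y, hy⟩ ω)
      (fun ω : ℝ => regularExp hx hα ⟨y, hy.1.le, hy.2.trans hb1⟩ ω) atTop K := by
  obtain ⟨ε, D, hb⟩ := hζ.exists_bounds
  obtain ⟨W, hW⟩ := hK.isBounded.exists_norm_le
  rw [Metric.tendstoUniformlyOn_iff]
  intro δ hδ
  have hlim := (tendsto_spacing x₀ b).const_mul (globalConst x₀ x₁ ε D W)
  rw [mul_zero] at hlim
  filter_upwards [hlim.eventually (gt_mem_nhds hδ)] with n hn ω hω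
  rw [dist_comm, dist_eq_norm]
  exact (norm_singularExp_sub_regularExp_le hx hζ hb hα (hW ω hω) h0b hb1 (hs n) hy).trans_lt hn

theorem singularExp_eq_eval_dualPsi {b : ℝ} (h0b : x₀ < b) (n : ℕ)
    (hs : IsStepPlus x₀ b (standardApprox x₀ b ζ n)) (ω : ℝ) :
    singularExp hs ⟨b, h0b, le_rfl⟩ ω =
      (dualPsi x₀ b ζ n).eval (Complex.exp (2 * Complex.I * spacing x₀ b n * ω)) := by
  have hΔ := spacing_pos h0b n
  have h1 : ((n : ℝ) + 1) * spacing x₀ b n = b - x₀ := by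
    unfold spacing; field_simp
  rw [eval_dualPsi]
  exact singularExp_standardApprox h0b hs ω (by simp only; linarith) (by simp only; linarith)

end Compare

end HarmonicExponential

end

open HarmonicExponential in
theorem mainTheorem11 (x₀ x₁ : ℝ) (hx : x₀ < x₁) (ζ : ℝ → ℝ) (hζ : IsC1Plus x₀ x₁ ζ) :
    ∃ hα : IntegrableOn (alpha ζ) (Ioo x₀ x₁),
      -- the inverses in the definitions of the two harmonic exponentials exist
      (∀ ω : ℝ, IsUnit (1 - opA hx.le hα ω)) ∧
      (∀ (n : ℕ) (ω : ℝ), IsUnit (1 - opZ (isStepPlus_standardApprox hx hζ.pos n) ω)) ∧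
      ∀ (y : ℝ) (hy : y ∈ Ioc x₀ x₁),
        -- convergence of the singular harmonic exponentials, uniformly on compact sets
        (∀ K : Set ℝ, IsCompact K →
          TendstoUniformlyOn
            (fun (n : ℕ) (ω : ℝ) =>
              singularExp (isStepPlus_standardApprox hx hζ.pos n) ⟨y, hy⟩ ω)
            (fun ω : ℝ => regularExp hx.le hα ⟨y, Ioc_subset_Icc_self hy⟩ ω) atTop K) ∧
        -- on `(x₀, y)` the inverse exists too, and the singular harmonic exponentials are
        -- values of dual OPUC
        (∀ (n : ℕ) (ω : ℝ), IsUnit (1 - opZ (isStepPlus_standardApprox hy.1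
          (fun x h => hζ.pos x (Ioo_subset_Ioo_right hy.2 h)) n) ω)) ∧
        (∀ n : ℕ, 1 ≤ n → ∀ ω : ℝ,
          singularExp
              (isStepPlus_standardApprox hy.1
                (fun x h => hζ.pos x (Ioo_subset_Ioo_right hy.2 h)) n) ⟨y, hy.1, le_rfl⟩ ω =
            (dualPsi x₀ y ζ n).eval (Complex.exp (2 * Complex.I * spacing x₀ y n * ω))) ∧
        -- and these dual OPUC converge to the regular harmonic exponential
        (∀ K : Set ℝ, IsCompact K →
          TendstoUniformlyOn
            (fun (n : ℕ) (ω : ℝ) =>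
              (dualPsi x₀ y ζ n).eval (Complex.exp (2 * Complex.I * spacing x₀ y n * ω)))
            (fun ω : ℝ => regularExp hx.le hα ⟨y, Ioc_subset_Icc_self hy⟩ ω) atTop K) := by

  have hα := hζ.integrableOn_alpha
  obtain ⟨ε, D, hb⟩ := hζ.exists_bounds
  refine ⟨hα, isUnit_one_sub_opA hx.le hα hb.M_nonneg fun x h => hb.abs_alpha_le h,
    fun n ω => isUnit_one_sub_opZ _ ω, fun y hy => ⟨fun K hK => ?_,
      fun n ω => isUnit_one_sub_opZ _ ω, fun n _ ω => singularExp_eq_eval_dualPsi hy.1 n _ ω,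
      fun K hK => ?_⟩⟩
  · exact tendstoUniformlyOn_singularExp hx.le hζ hα hx le_rfl _ hy hK
  · refine (tendstoUniformlyOn_singularExp hx.le hζ hα hy.1 hy.2
      (fun n => isStepPlus_standardApprox hy.1
        (fun x h => hζ.pos x (Ioo_subset_Ioo_right hy.2 h)) n) ⟨hy.1, le_rfl⟩ hK).congr ?_
    exact Eventually.of_forall fun n ω _ => singularExp_eq_eval_dualPsi hy.1 n _ ω
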